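/- **Setting.** Consider the system $x_{k+1}=Ax_k+Bu_k$, $y_k=Cx_k+Du_k$ with $x_k\in\mathbb R^n$, $u_k\in\mathbb R^m$, $y_k\in\mathbb R^p$, where $(A,B)$ is controllable and $(A,C)$ is observable. Let $\underline l$ be its lag, i.e. the smallest $j\in\{1,\dots,n\}$ such that the matrix with block rows $C,CA,\dots,CA^{j-1}$ has rank $n$, and let $l\ge\underline l$, $L\ge1$. For an input-output sequence let $\xi_t=(u_{t-l},\dots,u_{t-1},y_{t-l},\dots,y_{t-1})\in\mathbb R^{(m+p)l}$ be the extended state, and let $F_i,G_i$ ($1\le i\le l$) be matrices such that $y_k=\sum_{i=1}^l(F_iy_{k-i}+G_iu_{k-i})+Du_k$ along every trajectory of the system. Write the resulting dynamics of the extended state as $\xi_{k+1}=\tilde A\xi_k+\tilde Bu_k$, $y_k=\tilde C\xi_k+\tilde Du_k$, where $\tilde A,\tilde B$ consist of the block shifts and of the rows $(G_l,\dots,G_1,F_l,\dots,F_1)=\tilde C$ and $D=\tilde D$. Let $\mathbb U\subseteq\mathbb R^m$, $\mathbb Y\subseteq\mathbb R^p$, and let $(u^s,y^s)\in\mathrm{int}(\mathbb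 U\times\mathbb Y)$ be an equilibrium, i.e. the constant sequence $(u^s,y^s)$ of length $\underline l+1$ is a trajectory of the system; let $\xi^s=(u^s,\dots,u^s,y^s,\dots,y^s)$. Let $Q\succ0$, $R\succ0$, and let $\{u^d_k,y^d_k\}_{k=0}^{N-1}$ be a trajectory of the system. $H_T(v)$ denotes the Hankel matrix with $T$ block rows of $\{v_k\}_{k=0}^{N-1}$; $v$ is persistently exciting of order $T$ if $H_T(v)$ has full row rank. Write $\|x\|_P^2=x^\top Px$. **MPC problem.** For a given $\xi\in\mathbb R^{(m+p)l}$, minimize $$\sum_{k=0}^{L-1}\big(\|\bar u_k-u^s\|_R^2+\|\bar y_k-y^s\|_Q^2\big)+\|\bar\xi_L-\xi^s\|_P^2$$ over $\alpha\in\mathbb R^{N-L-l+1}$ and $\bar u_{-l},\dots,\bar u_{L-1}$, $\bar y_{-l},\dots,\bar y_{L-1}$, subject to $\bar u_{[-l,L-1]}=H_{L+l}(u^d)\alpha$, $\bar y_{[-l,L-1]}=H_{L+l}(y^d)\alpha$, $(\bar u_{[-l,-1]},\bar y_{[-l,-1]})=\xi$, $\bar\xi_L:=(\bar u_{[L-l,L-1]},\bar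 y_{[L-l,L-1]})\in\Xi_f$, and $\bar u_k\in\mathbb U$, $\bar y_k\in\mathbb Y$ for $0\le k\le L-1$. Let $J_L^*(\xi)$ be the optimal cost. In closed loop, the system runs from time $-l$ on, and at every time $t\ge0$ at which the problem with $\xi=\xi_t$ is feasible, the input $u_t=\bar u_0^*$ of some optimal solution (assumed to exist) is applied. **Assumption 1.** $P=P^\top\succ0$, $K\in\mathbb R^{m\times(m+p)l}$ and $\Xi_f\subseteq\mathbb U^l\times\mathbb Y^l$ with $\xi^s\in\mathrm{int}(\Xi_f)$ are such that for all $\xi\in\Xi_f$, with $u=u^s+K(\xi-\xi^s)$ and $y=\tilde C\xi+\tilde Du$: (i) $\tilde A\xi+\tilde Bu\in\Xi_f$; (ii) $u\in\mathbb U$ and $y\in\mathbb Y$; (iii) $\|(\tilde A+\tilde BK)(\xi-\xi^s)\|_P^2\le\|\xi-\xi^s\|_P^2-\|\xi-\xi^s\|_{K^\top RK}^2-\|y-y^s\|_Q^2$. **Assumption 2.** There is $c_u>0$ such that $J_L^*(\xi)\le c_u\|\xi-\xi^s\|_2^2$ for all $\xi$ for which the MPC problem is feasible. **Theorem.** Suppose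 that Assumptions 1 and 2 hold and that $u^d$ is persistently exciting of order $L+l+n$. If the MPC problem is feasible at time $t=0$, then in closed loop (i) it is feasible at every time $t\ge0$; (ii) $u_t\in\mathbb U$ and $y_t\in\mathbb Y$ for all $t\ge0$; (iii) $\xi^s$ is exponentially stable: there are $c>0$ and $\rho\in(0,1)$ such that $\|\xi_t-\xi^s\|_2\le c\,\rho^t\,\|\xi_0-\xi^s\|_2$ for all $t\ge0$ and for every closed-loop run whose initial extended state $\xi_0$ makes the problem feasible. Moreover, the problem is feasible for every $\xi_0$ in some neighborhood of $\xi^s$ that is generated by the system. -/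

import Mathlib

namespace DDMPC

open Matrix

/-! ### Linear systems, trajectories, persistence of excitation -/

/-- The matrices of `x⁺ = A x + B u`, `y = C x + D u` with state in `ℝⁿ`, input in `ℝᵐ`,
output in `ℝᵖ`. -/
structure LTI (n m p : ℕ) where
  A : Matrix (Fin n) (Fin n) ℝ
  B : Matrix (Fin n) (Fin m) ℝ
  C : Matrix (Fin p) (Fin n) ℝ
  D : Matrix (Fin p) (Fin m) ℝ

/-- `[B, A B, …, A^(n-1) B]`. -/
def LTI.ctrbMatrix {n m p : ℕ} (S : LTI n m p) : Matrix (Fin n) (Fin n × Fin m) ℝ :=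
  Matrix.of fun i ka => (S.A ^ (ka.1 : ℕ) * S.B) i ka.2

/-- The observability matrix `Φ_j`, with block rows `C, C A, …, C A^(j-1)`. -/
def LTI.obsvMatrix {n m p : ℕ} (S : LTI n m p) (j : ℕ) : Matrix (Fin j × Fin p) (Fin n) ℝ :=
  Matrix.of fun ka i => (S.C * S.A ^ (ka.1 : ℕ)) ka.2 i

def LTI.Controllable {n m p : ℕ} (S : LTI n m p) : Prop := S.ctrbMatrix.rank = n

def LTI.Observable {n m p : ℕ} (S : LTI n m p) : Prop := (S.obsvMatrix n).rank = n

/-- `l₀` is the lag: the smallest `j ∈ {1, …, n}` such that `Φ_j` has rank `n`. -/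
def LTI.IsLag {n m p : ℕ} (S : LTI n m p) (l₀ : ℕ) : Prop :=
  IsLeast {j : ℕ | 1 ≤ j ∧ j ≤ n ∧ (S.obsvMatrix j).rank = n} l₀

/-- State, input and output satisfy the system equations at time `k`. -/
def LTI.StepAt {n m p : ℕ} (S : LTI n m p) (x : ℕ → Fin n → ℝ) (u : ℕ → Fin m → ℝ)
    (y : ℕ → Fin p → ℝ) (k : ℕ) : Prop :=
  x (k + 1) = S.A *ᵥ x k + S.B *ᵥ u k ∧ y k = S.C *ᵥ x k + S.D *ᵥ u k

/-- The first `T` entries of `u`, `y` form an input-output trajectory of length `T`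
(later entries are irrelevant). -/
def LTI.IsTrajectory {n m p : ℕ} (S : LTI n m p) (T : ℕ) (u : ℕ → Fin m → ℝ)
    (y : ℕ → Fin p → ℝ) : Prop :=
  ∃ x : ℕ → Fin n → ℝ, ∀ k < T, S.StepAt x u y k

/-- `(us, ys)` is an input-output equilibrium: the constant sequence of length `l₀ + 1`, with
`l₀` the lag, is a trajectory. -/
def LTI.IsEquilibrium {n m p : ℕ} (S : LTI n m p) (l₀ : ℕ) (us : Fin m → ℝ)
    (ys : Fin p → ℝ) : Prop :=
  S.IsTrajectory (l₀ + 1) (fun _ => us) (fun _ => ys)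

/-- The Hankel matrix `H_T` of the first `N` entries of `v`, with block entries `v (i + j)`;
there are `N - T + 1` columns, and none if `N < T`. -/
def hankel {q : ℕ} (T N : ℕ) (v : ℕ → Fin q → ℝ) :
    Matrix (Fin T × Fin q) (Fin (N + 1 - T)) ℝ :=
  Matrix.of fun ia j => v ((ia.1 : ℕ) + (j : ℕ)) ia.2

/-- The stacked vector of the first `T` entries of `v`. -/
def stack {q : ℕ} (T : ℕ) (v : ℕ → Fin q → ℝ) : Fin T × Fin q → ℝ :=
  fun ia => v ia.1 ia.2

/-- The first `N` entries of `v` are persistently exciting of order `T`. -/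
def PersistentlyExciting {q : ℕ} (T N : ℕ) (v : ℕ → Fin q → ℝ) : Prop :=
  (hankel T N v).rank = q * T

/-! ### Extended state -/

/-- Index type of the extended state: `l` input blocks, then `l` output blocks, oldest first. -/
abbrev ExtIdx (l m p : ℕ) : Type := (Fin l × Fin m) ⊕ (Fin l × Fin p)

/-- The window `(u_[t, t+l-1], y_[t, t+l-1])` as a stacked vector. -/
def window (l : ℕ) {m p : ℕ} (u : ℕ → Fin m → ℝ) (y : ℕ → Fin p → ℝ) (t : ℕ) :
    ExtIdx l m p → ℝ :=
  Sum.elim (fun ia => u (t + (ia.1 : ℕ)) ia.2) (fun ia => y (t + (ia.1 : ℕ)) ia.2)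

/-- The stacked constant setpoint. -/
def constExt (l : ℕ) {m p : ℕ} (us : Fin m → ℝ) (ys : Fin p → ℝ) : ExtIdx l m p → ℝ :=
  window l (fun _ => us) (fun _ => ys) 0

/-- `x ↦ xᵀ P x`. -/
def wsq {ι : Type*} [Fintype ι] (P : Matrix ι ι ℝ) (x : ι → ℝ) : ℝ := x ⬝ᵥ (P *ᵥ x)

/-- The Euclidean norm. -/
noncomputable def norm2 {ι : Type*} [Fintype ι] (x : ι → ℝ) : ℝ := ‖WithLp.toLp 2 x‖

/-- The block shift, with identity blocks on the upper block diagonal. -/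
def shiftMatrix (l q : ℕ) : Matrix (Fin l × Fin q) (Fin l × Fin q) ℝ :=
  Matrix.of fun ia jb => if (jb.1 : ℕ) = (ia.1 : ℕ) + 1 ∧ ia.2 = jb.2 then 1 else 0

/-- The block row `[M_l, M_(l-1), …, M_1]`. -/
def coeffRow (l : ℕ) {p q : ℕ} (M : ℕ → Matrix (Fin p) (Fin q) ℝ) :
    Matrix (Fin p) (Fin l × Fin q) ℝ :=
  Matrix.of fun a jb => M (l - (jb.1 : ℕ)) a jb.2

/-- The block column `[0, …, 0, M]` with `l` blocks. -/
def lastBlock (l : ℕ) {q : ℕ} {κ : Type*} (M : Matrix (Fin q) κ ℝ) :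
    Matrix (Fin l × Fin q) κ ℝ :=
  Matrix.of fun ia j => if (ia.1 : ℕ) + 1 = l then M ia.2 j else 0

/-- The coefficients `F_1, …, F_l`, `G_1, …, G_l` (other indices are irrelevant) and `D` of
`y_k = ∑ i, (F_i y_(k-i) + G_i u_(k-i)) + D u_k`. -/
structure ARX (m p : ℕ) where
  F : ℕ → Matrix (Fin p) (Fin p) ℝ
  G : ℕ → Matrix (Fin p) (Fin m) ℝ
  D : Matrix (Fin p) (Fin m) ℝ

/-- `Ã`. -/
def ARX.At {m p : ℕ} (E : ARX m p) (l : ℕ) : Matrix (ExtIdx l m p) (ExtIdx l m p) ℝ :=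
  Matrix.fromBlocks (shiftMatrix l m) 0
    (lastBlock l (coeffRow l E.G)) (shiftMatrix l p + lastBlock l (coeffRow l E.F))

/-- `B̃`. -/
def ARX.Bt {m p : ℕ} (E : ARX m p) (l : ℕ) : Matrix (ExtIdx l m p) (Fin m) ℝ :=
  Matrix.fromRows (lastBlock l (1 : Matrix (Fin m) (Fin m) ℝ)) (lastBlock l E.D)

/-- `C̃`. -/
def ARX.Ct {m p : ℕ} (E : ARX m p) (l : ℕ) : Matrix (Fin p) (ExtIdx l m p) ℝ :=
  Matrix.fromCols (coeffRow l E.G) (coeffRow l E.F)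

/-- `D̃`. -/
def ARX.Dt {m p : ℕ} (E : ARX m p) : Matrix (Fin p) (Fin m) ℝ := E.D

/-- The extended-state equations `ξ⁺ = Ã ξ + B̃ u`, `y = C̃ ξ + D̃ u` hold along every
trajectory of the system. By time invariance it suffices to ask this at one time step. -/
def ARX.Describes {n m p : ℕ} (E : ARX m p) (l : ℕ) (S : LTI n m p) : Prop :=
  E.D = S.D ∧
  ∀ (u : ℕ → Fin m → ℝ) (y : ℕ → Fin p → ℝ), S.IsTrajectory (l + 1) u y →
    window l u y 1 = E.At l *ᵥ window l u y 0 + E.Bt l *ᵥ u l ∧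
    y l = E.Ct l *ᵥ window l u y 0 + E.Dt *ᵥ u l

/-! ### The optimal control problem -/

/-- The data of the optimal control problem: measured data `ud`, `yd` (the first `N` entries),
weights `Q`, `R`, `P`, constraint sets `U`, `Y`, terminal set `Xf`, setpoint `(us, ys)`.
`l` is the length of the initial condition and `L` is the horizon. -/
structure MPC (m p l L N : ℕ) where
  ud : ℕ → Fin m → ℝ
  yd : ℕ → Fin p → ℝ
  Q : Matrix (Fin p) (Fin p) ℝ
  R : Matrix (Fin m) (Fin m) ℝ
  P : Matrix (ExtIdx l m p) (ExtIdx l m p) ℝ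
  U : Set (Fin m → ℝ)
  Y : Set (Fin p → ℝ)
  Xf : Set (ExtIdx l m p → ℝ)
  us : Fin m → ℝ
  ys : Fin p → ℝ

namespace MPC

variable {m p l L N : ℕ}

/-- The setpoint of the extended state. -/
def xis (M : MPC m p l L N) : ExtIdx l m p → ℝ := constExt l M.us M.ys

/-- Decision variables. The entry with index `l + k` of `u`, `y` is the prediction for step `k`,
where `k` runs from `-l` to `L - 1`; entries with index `≥ L + l` are irrelevant. -/
structure Decision (m p l L N : ℕ) where
  α : Fin (N + 1 - (L + l)) → ℝ
  u : ℕ → Fin m → ℝ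
  y : ℕ → Fin p → ℝ

/-- `d` satisfies all constraints of the problem with initial condition `ξ`. -/
structure IsFeasible (M : MPC m p l L N) (ξ : ExtIdx l m p → ℝ) (d : Decision m p l L N) :
    Prop where
  hankel_u : stack (L + l) d.u = hankel (L + l) N M.ud *ᵥ d.α
  hankel_y : stack (L + l) d.y = hankel (L + l) N M.yd *ᵥ d.α
  init : window l d.u d.y 0 = ξ
  terminal : window l d.u d.y L ∈ M.Xf
  input : ∀ k < L, d.u (l + k) ∈ M.U
  output : ∀ k < L, d.y (l + k) ∈ M.Y

def cost (M : MPC m p l L N) (d : Decision m p l L N) : ℝ :=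
  (∑ k ∈ Finset.range L, (wsq M.R (d.u (l + k) - M.us) + wsq M.Q (d.y (l + k) - M.ys)))
    + wsq M.P (window l d.u d.y L - M.xis)

/-- The problem with initial condition `ξ` is feasible. -/
def Feasible (M : MPC m p l L N) (ξ : ExtIdx l m p → ℝ) : Prop := ∃ d, M.IsFeasible ξ d

/-- `d` is an optimal solution for the initial condition `ξ`. -/
def IsOptimal (M : MPC m p l L N) (ξ : ExtIdx l m p → ℝ) (d : Decision m p l L N) : Prop :=
  M.IsFeasible ξ d ∧ ∀ d', M.IsFeasible ξ d' → M.cost d ≤ M.cost d'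

/-- The optimal cost (used only where the problem is feasible; all costs are nonnegative when
the weights are positive definite). -/
noncomputable def value (M : MPC m p l L N) (ξ : ExtIdx l m p → ℝ) : ℝ :=
  sInf (M.cost '' {d | M.IsFeasible ξ d})

/-- The terminal ingredients `P`, `K`, `Xf`. -/
structure TerminalIngredients (M : MPC m p l L N) (E : ARX m p)
    (K : Matrix (Fin m) (ExtIdx l m p) ℝ) : Prop where
  posDef : M.P.PosDef
  subset : ∀ ξ ∈ M.Xf, (∀ i, (fun a => ξ (Sum.inl (i, a))) ∈ M.U) ∧
    ∀ i, (fun a => ξ (Sum.inr (i, a))) ∈ M.Y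
  setpoint : M.xis ∈ interior M.Xf
  invariant : ∀ ξ ∈ M.Xf, E.At l *ᵥ ξ + E.Bt l *ᵥ (M.us + K *ᵥ (ξ - M.xis)) ∈ M.Xf
  input : ∀ ξ ∈ M.Xf, M.us + K *ᵥ (ξ - M.xis) ∈ M.U
  output : ∀ ξ ∈ M.Xf, E.Ct l *ᵥ ξ + E.Dt *ᵥ (M.us + K *ᵥ (ξ - M.xis)) ∈ M.Y
  decrease : ∀ ξ ∈ M.Xf,
    wsq M.P ((E.At l + E.Bt l * K) *ᵥ (ξ - M.xis)) ≤
      wsq M.P (ξ - M.xis) - wsq (Kᵀ * M.R * K) (ξ - M.xis)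
        - wsq M.Q (E.Ct l *ᵥ ξ + E.Dt *ᵥ (M.us + K *ᵥ (ξ - M.xis)) - M.ys)

/-- The optimal value function is quadratically upper bounded where the problem is feasible. -/
def QuadUpperBound (M : MPC m p l L N) : Prop :=
  ∃ cu : ℝ, 0 < cu ∧ ∀ ξ, M.Feasible ξ → M.value ξ ≤ cu * norm2 (ξ - M.xis) ^ 2

/-- `x`, `u`, `y` is a closed-loop run. The entry with index `l + t` belongs to time `t ≥ -l`, so
that `window l u y t` is the extended state `ξ_t` made of the `l` measurements before time `t`.
The sequences obey the system from time `-l` on, the inputs before time `0` being arbitrary. At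
every time `t ≥ 0` at which the problem is feasible, the applied input is the first input of some
optimal solution (any one, if there are several). -/
structure ClosedLoop {n : ℕ} (M : MPC m p l L N) (S : LTI n m p) (x : ℕ → Fin n → ℝ)
    (u : ℕ → Fin m → ℝ) (y : ℕ → Fin p → ℝ) : Prop where
  plant : ∀ k, S.StepAt x u y k
  control : ∀ t, M.Feasible (window l u y t) →
    ∃ d, M.IsOptimal (window l u y t) d ∧ u (l + t) = d.u l

/-- The setpoint is exponentially stable for the closed loop, the region of attraction being the
set of all initial extended states for which the problem is feasible. This region contains all
extended states near the setpoint that the system can produce, and the constants `c`, `ρ` are the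
same for all closed-loop runs that start in it. -/
def ExponentiallyStable {n : ℕ} (M : MPC m p l L N) (S : LTI n m p) : Prop :=
  (∃ δ : ℝ, 0 < δ ∧ ∀ u y, S.IsTrajectory l u y →
    norm2 (window l u y 0 - M.xis) < δ → M.Feasible (window l u y 0)) ∧
  ∃ c ρ : ℝ, 0 < c ∧ 0 < ρ ∧ ρ < 1 ∧ ∀ x u y, M.ClosedLoop S x u y →
    M.Feasible (window l u y 0) →
    ∀ t : ℕ, norm2 (window l u y t - M.xis) ≤ c * ρ ^ t * norm2 (window l u y 0 - M.xis)

end MPC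

end DDMPC

/-!
By Willems' fundamental lemma, the combinations of data windows are exactly the trajectories of
length `L + l`, so the data-driven problem optimizes over genuine trajectories of the system.
Extending an optimal trajectory by one step of the terminal control law and dropping its first step
gives a candidate for the next extended state, whose cost is smaller by at least the first stage
cost. Hence feasibility propagates and the optimal value decreases by the stage cost.

The stage cost only controls the newest entry of the extended state, and the optimal value need not
be bounded below by the squared norm of the whole window. Adding a small multiple of the window
sum of squares with linearly increasing weights repairs both: the weights of the entries already in
the window drop by one in each step, and the stage cost pays for the entering one. The resulting
function lies between multiples of the squared norm and decreases by a multiple of it.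
-/

namespace DDMPC

open Matrix

section FullRank

variable {F ι κ : Type*} [Field F] [Fintype κ] {W : Matrix ι κ F}

lemma mulVec_injective_of_rank_eq_card (h : W.rank = Fintype.card κ) :
    Function.Injective W.mulVec := by
  rw [mulVec_injective_iff, linearIndependent_iff_card_eq_finrank_span, ← h,
    rank_eq_finrank_span_cols]
  rfl

variable [Fintype ι]

lemma vecMul_injective_of_rank_eq_card (h : W.rank = Fintype.card ι) :
    Function.Injective W.vecMul := by
  rw [vecMul_injective_iff, linearIndependent_iff_card_eq_finrank_span, ← h,
    rank_eq_finrank_span_row]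
  rfl

lemma mulVec_surjective_of_vecMul_injective (h : Function.Injective W.vecMul) :
    Function.Surjective W.mulVec := by
  have hrank : W.rank = Module.finrank F (ι → F) := by
    rw [Module.finrank_fintype_fun_eq_card, (vecMul_injective_iff.1 h).rank_matrix]
  exact LinearMap.range_eq_top.1 (Submodule.eq_top_of_finrank_eq hrank)

end FullRank

section Quadratic

variable {ι κ : Type*} [Fintype ι] [Fintype κ] {P : Matrix ι ι ℝ}

lemma norm2_sq (z : ι → ℝ) : norm2 z ^ 2 = ∑ i, z i ^ 2 :=
  EuclideanSpace.real_norm_sq_eq _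

lemma wsq_nonneg (hP : P.PosSemidef) (z : ι → ℝ) : 0 ≤ wsq P z :=
  hP.dotProduct_mulVec_nonneg z

lemma wsq_transpose_mul_mul (R : Matrix κ κ ℝ) (K : Matrix κ ι ℝ) (z : ι → ℝ) :
    wsq (Kᵀ * R * K) z = wsq R (K *ᵥ z) := by
  rw [wsq, wsq, ← mulVec_mulVec, ← mulVec_mulVec, dotProduct_mulVec, vecMul_transpose]

open scoped MatrixOrder Matrix.Norms.L2Operator in
lemma exists_pos_mul_norm2_sq_le_wsq (hP : P.PosDef) :
    ∃ c : ℝ, 0 < c ∧ ∀ z, c * norm2 z ^ 2 ≤ wsq P z := by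
  classical
  cases isEmpty_or_nonempty ι
  · exact ⟨1, one_pos, fun z => by simp [norm2_sq, wsq]⟩
  obtain ⟨c, hc, hcP⟩ := (CFC.exists_pos_algebraMap_le_iff hP.1).2
    fun _ hx => hP.isStrictlyPositive.spectrum_pos hx
  refine ⟨c, hc, fun z => ?_⟩
  have h := wsq_nonneg hcP z
  rw [wsq, sub_mulVec, dotProduct_sub, Algebra.algebraMap_eq_smul_one, smul_mulVec, one_mulVec,
    dotProduct_smul, sub_nonneg] at h
  rw [norm2_sq]
  simpa [dotProduct, wsq, sq] using h

lemma exists_pos_norm2_sub_lt_imp_mem {s : Set (ι → ℝ)} {z₀ : ι → ℝ} (h : z₀ ∈ interior s) :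
    ∃ δ : ℝ, 0 < δ ∧ ∀ z, norm2 (z - z₀) < δ → z ∈ s := by
  have hs : WithLp.ofLp ⁻¹' s ∈ nhds (WithLp.toLp 2 z₀) :=
    (PiLp.continuous_ofLp 2 _).continuousAt (mem_interior_iff_mem_nhds.1 h)
  obtain ⟨δ, hδ, hball⟩ := Metric.mem_nhds_iff.1 hs
  refine ⟨δ, hδ, fun z hz => hball (a := WithLp.toLp 2 z) ?_⟩
  rwa [mem_ball_iff_norm]

end Quadratic

section Trajectory

variable {n m p T T' l₀ : ℕ} {S : LTI n m p} {x x' : ℕ → Fin n → ℝ} {u u' : ℕ → Fin m → ℝ}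
  {y y' : ℕ → Fin p → ℝ}

lemma LTI.IsTrajectory.mono (h : S.IsTrajectory T u y) (hT : T' ≤ T) : S.IsTrajectory T' u y :=
  let ⟨x, hx⟩ := h
  ⟨x, fun k hk => hx k (hk.trans_le hT)⟩

lemma LTI.IsTrajectory.congr (h : S.IsTrajectory T u y) (hu : ∀ k < T, u' k = u k)
    (hy : ∀ k < T, y' k = y k) : S.IsTrajectory T u' y' := by
  obtain ⟨x, hx⟩ := h
  refine ⟨x, fun k hk => ?_⟩
  rw [LTI.StepAt, hu k hk, hy k hk]
  exact hx k hk

lemma LTI.IsTrajectory.shift {t : ℕ} (h : S.IsTrajectory (t + T) u y) :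
    S.IsTrajectory T (fun k => u (t + k)) (fun k => y (t + k)) :=
  let ⟨x, hx⟩ := h
  ⟨fun k => x (t + k), fun k hk => hx (t + k) (Nat.add_lt_add_left hk t)⟩

lemma LTI.IsTrajectory.exists_update (h : S.IsTrajectory T u y) (v : Fin m → ℝ) :
    ∃ z, S.IsTrajectory (T + 1) (Function.update u T v) (Function.update y T z) := by
  obtain ⟨x, hx⟩ := h
  refine ⟨S.C *ᵥ x T + S.D *ᵥ v, Function.update x (T + 1) (S.A *ᵥ x T + S.B *ᵥ v),
    fun k hk => ?_⟩
  rcases Nat.lt_succ_iff_lt_or_eq.1 hk with hk | rfl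
  · simpa only [LTI.StepAt, ne_eq, Nat.add_right_cancel_iff, hk.ne, hk.le.not_gt,
      (Nat.lt_succ_of_lt hk).ne, not_false_eq_true, Function.update_of_ne] using hx k hk
  · simp [LTI.StepAt]

lemma LTI.output_eq_of_init_eq (hx : ∀ k < T, S.StepAt x u y k)
    (hx' : ∀ k < T, S.StepAt x' u' y' k) (hu : ∀ k < T, u k = u' k) (h₀ : x 0 = x' 0) :
    ∀ k < T, y k = y' k := by
  have hstate : ∀ k ≤ T, x k = x' k := by
    intro k
    induction k with
    | zero => exact fun _ => h₀
    | succ k ih => exact fun hk => by rw [(hx k hk).1, (hx' k hk).1, ih (by omega), hu k hk]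
  intro k hk
  rw [(hx k hk).2, (hx' k hk).2, hstate k hk.le, hu k hk]

lemma LTI.IsEquilibrium.of_rank_obsvMatrix {us : Fin m → ℝ} {ys : Fin p → ℝ}
    (h : S.IsEquilibrium l₀ us ys) (hobs : (S.obsvMatrix l₀).rank = n) (T : ℕ) :
    S.IsEquilibrium T us ys := by
  obtain ⟨x, hx⟩ := h
  have hdiff : ∀ k ≤ l₀, S.A ^ k *ᵥ (x 0 - x 1) = x k - x (k + 1) := by
    intro k
    induction k with
    | zero => simp
    | succ k ih =>
      intro hk
      rw [pow_succ', ← mulVec_mulVec, ih (by omega), mulVec_sub, (hx k (by omega)).1,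
        (hx (k + 1) (by omega)).1, (hx k (by omega)).1, add_sub_add_right_eq_sub]
  have hinit : x 0 = x 1 := by
    refine sub_eq_zero.1 (mulVec_injective_of_rank_eq_card (by rwa [Fintype.card_fin]) ?_)
    ext ⟨k, a⟩
    have hout : S.C *ᵥ x k = S.C *ᵥ x (k + 1) :=
      add_right_cancel ((hx k (by omega)).2.symm.trans (hx (k + 1) (by omega)).2)
    have hzero : (S.C * S.A ^ (k : ℕ)) *ᵥ (x 0 - x 1) = 0 := by
      rw [← mulVec_mulVec, hdiff k k.2.le, mulVec_sub, hout, sub_self]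
    rw [mulVec_zero]
    exact congrFun hzero a
  obtain ⟨hstate, hout⟩ := hx 0 (by omega)
  exact ⟨fun _ => x 0, fun _ _ => ⟨hinit.trans hstate, hout⟩⟩

end Trajectory

section FundamentalLemma

variable {n m p q T T' N : ℕ} {S : LTI n m p} {x : ℕ → Fin n → ℝ} {u : ℕ → Fin m → ℝ}
  {y : ℕ → Fin p → ℝ} {r : Fin n → ℝ} {g : ℕ → Fin m → ℝ}

lemma eq_zero_of_monic_recurrence {R V : Type*} [Semiring R] [AddCommMonoid V] [Module R V]
    {f : Polynomial R} (hf : f.Monic) {h : ℕ → V} {M : ℕ} (hM : ∀ s, M ≤ s → h s = 0)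
    (hrec : ∀ s < M,
      ∑ k ∈ Finset.range (f.natDegree + 1), f.coeff k • h (s + (f.natDegree - k)) = 0) :
    ∀ s, h s = 0 := by
  suffices hback : ∀ d s, M ≤ s + d → h s = 0 from fun s => hback M s (Nat.le_add_left M s)
  intro d
  induction d with
  | zero => exact hM
  | succ d ih =>
    intro s hs
    rcases le_or_gt M s with hMs | hMs
    · exact hM s hMs
    · have hlater : ∀ k ∈ Finset.range f.natDegree,
          f.coeff k • h (s + (f.natDegree - k)) = 0 := fun k hk => by
        rw [ih _ (by have := Finset.mem_range.1 hk; omega), smul_zero]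
      simpa [Finset.sum_range_succ, Finset.sum_eq_zero hlater, hf.coeff_natDegree] using hrec s hMs

/-- The linear functional with state coefficients `r` and input coefficients `g` vanishes on every
window of length `T` within the first `N` samples of `x`, `u`. Such functionals span the left
kernel of the matrix with block rows `H_T(u)` and the states at the starts of the windows. -/
def Annihilates (T N : ℕ) (r : Fin n → ℝ) (g : ℕ → Fin m → ℝ) (x : ℕ → Fin n → ℝ)
    (u : ℕ → Fin m → ℝ) : Prop :=
  ∀ j, j + T ≤ N → r ⬝ᵥ x j + ∑ s ∈ Finset.range T, g s ⬝ᵥ u (s + j) = 0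

/-- The input coefficients `(r A^(k-1) B, …, r B, g_0, g_1, …)` of the functional with coefficients
`r`, `g` evaluated `k` steps later, after the state at that time has been expressed by the system
equations. Its state coefficients are `r A^k`. -/
def LTI.pullback (S : LTI n m p) (r : Fin n → ℝ) (g : ℕ → Fin m → ℝ) : ℕ → ℕ → Fin m → ℝ
  | 0, s => g s
  | k + 1, 0 => r ᵥ* (S.A ^ k * S.B)
  | k + 1, s + 1 => S.pullback r g k s

lemma LTI.pullback_add (k s i : ℕ) :
    S.pullback r g (k + i) (s + i) = S.pullback r g k s := by
  induction i with
  | zero => rfl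
  | succ _ ih => exact ih

lemma LTI.pullback_eq_zero (hg : ∀ s, T ≤ s → g s = 0) {k s : ℕ} (hs : T + k ≤ s) :
    S.pullback r g k s = 0 := by
  obtain ⟨i, rfl⟩ := Nat.exists_eq_add_of_le' (Nat.le_of_add_left_le hs)
  simpa [LTI.pullback, hg i (by omega)] using S.pullback_add (r := r) (g := g) 0 i k

lemma Annihilates.pullback (h : Annihilates T N r g x u) (hx : ∀ k < N, S.StepAt x u y k)
    (k : ℕ) : Annihilates (T + k) N (r ᵥ* S.A ^ k) (S.pullback r g k) x u := by
  induction k with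
  | zero => simpa [LTI.pullback] using h
  | succ k ih =>
    intro j hj
    have hlater := ih (j + 1) (by omega)
    rw [(hx j (by omega)).1, dotProduct_add, dotProduct_mulVec, dotProduct_mulVec, vecMul_vecMul,
      vecMul_vecMul, ← pow_succ] at hlater
    rw [← add_assoc T, Finset.sum_range_succ', ← hlater]
    simp only [LTI.pullback, zero_add, add_assoc, add_comm 1 j, add_comm (_ ⬝ᵥ u j)]

lemma Annihilates.mono (h : Annihilates T N r g x u) (hT : T ≤ T')
    (hg : ∀ s, T ≤ s → g s = 0) : Annihilates T' N r g x u := by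
  intro j hj
  rw [← h j (by omega), ← Finset.sum_subset (Finset.range_mono hT)]
  intro s _ hs
  rw [hg s (by simpa using hs), zero_dotProduct]

lemma Annihilates.sum_smul {ι : Type*} {K : Finset ι} {c : ι → ℝ} {r : ι → Fin n → ℝ}
    {g : ι → ℕ → Fin m → ℝ} (h : ∀ k ∈ K, Annihilates T N (r k) (g k) x u) :
    Annihilates T N (∑ k ∈ K, c k • r k) (fun s => ∑ k ∈ K, c k • g k s) x u := by
  intro j hj
  simp only [sum_dotProduct, smul_dotProduct]
  rw [Finset.sum_comm, ← Finset.sum_add_distrib]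
  refine Finset.sum_eq_zero fun k hk => ?_
  rw [← Finset.smul_sum, ← smul_add, h k hk j hj, smul_zero]

lemma vecMul_hankel_apply (v : ℕ → Fin q → ℝ) (g : ℕ → Fin q → ℝ) (j : Fin (N + 1 - T)) :
    (stack T g ᵥ* hankel T N v) j = ∑ s ∈ Finset.range T, g s ⬝ᵥ v (s + j) := by
  rw [← Fin.sum_univ_eq_sum_range (fun s => g s ⬝ᵥ v (s + j)) T]
  simp only [vecMul, dotProduct, Fintype.sum_prod_type, stack, hankel, of_apply]

lemma PersistentlyExciting.eq_zero_of_annihilates (hu : PersistentlyExciting T N u)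
    (h : Annihilates T N 0 g x u) : ∀ s < T, g s = 0 := by
  have hstack : stack T g = 0 := by
    refine vecMul_injective_of_rank_eq_card (hu.trans (by simp [mul_comm])) ?_
    ext j
    beta_reduce
    rw [vecMul_hankel_apply, zero_vecMul, Pi.zero_apply, ← h j (by omega), zero_dotProduct,
      zero_add]
  exact fun s hs => funext fun a => congrFun hstack (⟨s, hs⟩, a)

lemma Annihilates.pullback_eq_zero (h : Annihilates T N r g x u)
    (hx : ∀ k < N, S.StepAt x u y k) (hpe : PersistentlyExciting (T + n) N u)
    (hg : ∀ s, T ≤ s → g s = 0) : ∀ s, S.pullback r g n s = 0 := by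
  -- In the combination of the pullbacks with the coefficients of the characteristic polynomial the
  -- state drops out by Cayley-Hamilton, so excitation kills its input coefficients. They are a
  -- monic recurrence for the coefficients of the last pullback, which have finite support.
  have hdeg : S.A.charpoly.natDegree = n := by simp [charpoly_natDegree_eq_dim]
  have hcayley : ∑ k ∈ Finset.range (n + 1), S.A.charpoly.coeff k • (r ᵥ* S.A ^ k) = 0 := by
    have := congrArg (r ᵥ* ·) S.A.aeval_self_charpoly
    simpa only [Polynomial.aeval_eq_sum_range, hdeg, vecMul_sum, vecMul_smul, vecMul_zero]
      using this
  have hcomb : Annihilates (T + n) N (∑ k ∈ Finset.range (n + 1),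
      S.A.charpoly.coeff k • (r ᵥ* S.A ^ k))
      (fun s => ∑ k ∈ Finset.range (n + 1), S.A.charpoly.coeff k • S.pullback r g k s) x u :=
    Annihilates.sum_smul fun k hk => (h.pullback hx k).mono
      (by have := Finset.mem_range.1 hk; omega) fun s => LTI.pullback_eq_zero hg
  rw [hcayley] at hcomb
  refine eq_zero_of_monic_recurrence S.A.charpoly_monic (M := T + n)
    (fun s => LTI.pullback_eq_zero hg) fun s hs => ?_
  rw [hdeg, ← hpe.eq_zero_of_annihilates hcomb s hs]
  refine Finset.sum_congr rfl fun k hk => ?_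
  rw [← S.pullback_add k s (n - k), Nat.add_sub_cancel' (Finset.mem_range_succ_iff.1 hk)]

lemma Annihilates.eq_zero (h : Annihilates T N r g x u) (hctrb : S.Controllable)
    (hx : ∀ k < N, S.StepAt x u y k) (hpe : PersistentlyExciting (T + n) N u)
    (hg : ∀ s, T ≤ s → g s = 0) : r = 0 ∧ ∀ s, g s = 0 := by
  have hzero := h.pullback_eq_zero hx hpe hg
  constructor
  · refine vecMul_injective_of_rank_eq_card (hctrb.trans (Fintype.card_fin n).symm) ?_
    ext ⟨k, b⟩
    have hk : r ᵥ* (S.A ^ (k : ℕ) * S.B) = 0 := by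
      have := S.pullback_add (r := r) (g := g) (k + 1) 0 (n - (k + 1))
      rwa [Nat.add_sub_cancel' (Nat.succ_le_of_lt k.2), hzero, eq_comm] at this
    beta_reduce
    rw [zero_vecMul]
    exact congrFun hk b
  · intro s
    simpa [LTI.pullback, hzero] using (S.pullback_add (r := r) (g := g) 0 s n).symm

/-- The matrix of the states at the starts of the windows of length `T` of the first `N` samples;
its columns correspond to those of `hankel T N`. -/
def stateMatrix (T N : ℕ) (x : ℕ → Fin n → ℝ) : Matrix (Fin n) (Fin (N + 1 - T)) ℝ :=
  Matrix.of fun i j => x j i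

lemma fromRows_hankel_stateMatrix_mulVec_surjective (hctrb : S.Controllable)
    (hx : ∀ k < N, S.StepAt x u y k) (hpe : PersistentlyExciting (T + n) N u) :
    Function.Surjective (fromRows (hankel T N u) (stateMatrix T N x)).mulVec := by
  refine mulVec_surjective_of_vecMul_injective ((injective_iff_map_eq_zero
    (fromRows (hankel T N u) (stateMatrix T N x)).vecMulLinear).2 fun w hw => ?_)
  let r : Fin n → ℝ := fun i => w (Sum.inr i)
  let g : ℕ → Fin m → ℝ := fun s b => if hs : s < T then w (Sum.inl (⟨s, hs⟩, b)) else 0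
  have hw_eq : w = Sum.elim (stack T g) r := by
    ext (⟨s, b⟩ | i) <;> simp [stack, g, r]
  have hann : Annihilates T N r g x u := by
    intro j hj
    have := congrFun hw ⟨j, by omega⟩
    rw [vecMulLinear_apply, hw_eq, sumElim_vecMul_fromRows, Pi.add_apply, vecMul_hankel_apply,
      add_comm] at this
    exact this
  obtain ⟨hr, hg⟩ := hann.eq_zero hctrb hx hpe fun s hs => by ext b; simp [g, hs.not_gt]
  rw [hw_eq, hr, show g = 0 from funext hg]
  ext (_ | _) <;> rfl

/-- The combination of the first `K` shifts of `v` with coefficients `α`, that is, the signal whose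
stacked vector is `hankel T N v *ᵥ α`. -/
def shiftCombination {K : ℕ} (α : Fin K → ℝ) (v : ℕ → Fin q → ℝ) : ℕ → Fin q → ℝ :=
  fun k => ∑ j, α j • v (k + j)

lemma hankel_mulVec (v : ℕ → Fin q → ℝ) (α : Fin (N + 1 - T) → ℝ) :
    hankel T N v *ᵥ α = stack T (shiftCombination α v) := by
  ext ⟨k, a⟩
  simp [stack, hankel, shiftCombination, mulVec, dotProduct, mul_comm]

lemma stack_eq_stack_iff {v w : ℕ → Fin q → ℝ} : stack T v = stack T w ↔ ∀ k < T, v k = w k :=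
  ⟨fun h k hk => funext fun a => congrFun h (⟨k, hk⟩, a),
    fun h => funext fun i => congrFun (h i.1 i.1.2) i.2⟩

lemma LTI.StepAt.shiftCombination {K k : ℕ} (α : Fin K → ℝ)
    (h : ∀ j : Fin K, S.StepAt x u y (k + j)) :
    S.StepAt (shiftCombination α x) (shiftCombination α u) (shiftCombination α y) k := by
  simp only [LTI.StepAt, DDMPC.shiftCombination, mulVec_sum, mulVec_smul,
    ← Finset.sum_add_distrib, ← smul_add, add_right_comm k 1, (h _).1, (h _).2, and_self]

/-- The behavior of `S` on windows of length `T` is the image of the Hankel matrices of the first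
`N` samples of the data `ud`, `yd`: the property of the data on which data-driven control rests. -/
def LTI.IsRepresentedBy (S : LTI n m p) (T N : ℕ) (ud : ℕ → Fin m → ℝ) (yd : ℕ → Fin p → ℝ) :
    Prop :=
  ∀ u y, S.IsTrajectory T u y ↔
    ∃ α, stack T u = hankel T N ud *ᵥ α ∧ stack T y = hankel T N yd *ᵥ α

/-- **Willems' fundamental lemma**. -/
theorem LTI.Controllable.isRepresentedBy {ud : ℕ → Fin m → ℝ} {yd : ℕ → Fin p → ℝ}
    (hctrb : S.Controllable) (hdata : S.IsTrajectory N ud yd)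
    (hpe : PersistentlyExciting (T + n) N ud) : S.IsRepresentedBy T N ud yd := by
  obtain ⟨xd, hxd⟩ := hdata
  have hcomb : ∀ α : Fin (N + 1 - T) → ℝ, ∀ k < T, S.StepAt (shiftCombination α xd)
      (shiftCombination α ud) (shiftCombination α yd) k := fun α k hk =>
    LTI.StepAt.shiftCombination α fun j => hxd _ (by omega)
  intro u y
  simp only [hankel_mulVec, stack_eq_stack_iff]
  constructor
  · rintro ⟨x, hx⟩
    obtain ⟨α, hα⟩ := fromRows_hankel_stateMatrix_mulVec_surjective hctrb hxd hpe
      (Sum.elim (stack T u) (x 0))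
    rw [fromRows_mulVec, Sum.elim_eq_iff, hankel_mulVec, stack_eq_stack_iff] at hα
    obtain ⟨hu, hstate⟩ := hα
    have hx₀ : shiftCombination α xd 0 = x 0 := by
      rw [← hstate]
      ext i
      simp [shiftCombination, stateMatrix, mulVec, dotProduct, mul_comm]
    have hu' : ∀ k < T, u k = shiftCombination α ud k := fun k hk => (hu k hk).symm
    exact ⟨α, hu', LTI.output_eq_of_init_eq hx (hcomb α) hu' hx₀.symm⟩
  · rintro ⟨α, hu, hy⟩
    exact LTI.IsTrajectory.congr ⟨_, hcomb α⟩ hu hy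

end FundamentalLemma


section Window

variable {n m p l t t' : ℕ} {S : LTI n m p} {E : ARX m p} {u u' : ℕ → Fin m → ℝ}
  {y y' : ℕ → Fin p → ℝ}

lemma window_congr (hu : ∀ i < l, u (t + i) = u' (t' + i))
    (hy : ∀ i < l, y (t + i) = y' (t' + i)) : window l u y t = window l u' y' t' := by
  ext (⟨i, a⟩ | ⟨i, a⟩)
  · exact congrFun (hu i i.2) a
  · exact congrFun (hy i i.2) a

lemma window_shift (s : ℕ) :
    window l (fun k => u (s + k)) (fun k => y (s + k)) t = window l u y (s + t) :=
  window_congr (fun _ _ => by rw [add_assoc]) fun _ _ => by rw [add_assoc]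

lemma norm2_window_sub_constExt_sq (us : Fin m → ℝ) (ys : Fin p → ℝ) (t : ℕ) :
    norm2 (window l u y t - constExt l us ys) ^ 2 =
      ∑ i ∈ Finset.range l, (norm2 (u (t + i) - us) ^ 2 + norm2 (y (t + i) - ys) ^ 2) := by
  rw [← Fin.sum_univ_eq_sum_range
    (fun i => norm2 (u (t + i) - us) ^ 2 + norm2 (y (t + i) - ys) ^ 2) l]
  simp only [norm2_sq, Fintype.sum_sum_type, Fintype.sum_prod_type, Finset.sum_add_distrib,
    Pi.sub_apply, window, constExt, Sum.elim_inl, Sum.elim_inr]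

lemma ARX.Describes.step (hE : E.Describes l S) (h : S.IsTrajectory (t + (l + 1)) u y) :
    window l u y (t + 1) = E.At l *ᵥ window l u y t + E.Bt l *ᵥ u (l + t) ∧
      y (l + t) = E.Ct l *ᵥ window l u y t + E.Dt *ᵥ u (l + t) := by
  have hstep := hE.2 _ _ h.shift
  rwa [window_shift, window_shift, add_zero, add_comm t l] at hstep

lemma ARX.Describes.eq_of_window_eq (hE : E.Describes l S)
    (h : S.IsTrajectory (t + (l + 1)) u y) (h' : S.IsTrajectory (t' + (l + 1)) u' y')
    (hw : window l u y t = window l u' y' t') (hu : u (l + t) = u' (l + t')) :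
    window l u y (t + 1) = window l u' y' (t' + 1) ∧ y (l + t) = y' (l + t') := by
  obtain ⟨hwindow, houtput⟩ := hE.step h
  obtain ⟨hwindow', houtput'⟩ := hE.step h'
  rw [hwindow, houtput, hwindow', houtput', hw, hu]
  exact ⟨rfl, rfl⟩

lemma ARX.Describes.constExt_eq {us : Fin m → ℝ} {ys : Fin p → ℝ} (hE : E.Describes l S)
    (heq : S.IsEquilibrium l us ys) :
    constExt l us ys = E.At l *ᵥ constExt l us ys + E.Bt l *ᵥ us :=
  (hE.2 _ _ heq).1

end Window

section ExponentialDecay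

lemma le_geometric_of_sandwich {X W : ℕ → ℝ} {a b c : ℝ} (ha : 0 < a) (hb : 0 < b) (hc : 0 ≤ c)
    (hcb : c ≤ b) (hlower : ∀ t, a * X t ≤ W t) (hupper : ∀ t, W t ≤ b * X t)
    (hdecrease : ∀ t, W (t + 1) ≤ W t - c * X t) (t : ℕ) :
    X t ≤ b / a * (1 - c / b) ^ t * X 0 := by
  have hratio : 0 ≤ 1 - c / b := sub_nonneg.2 ((div_le_one hb).2 hcb)
  have hcontract : ∀ t, W (t + 1) ≤ (1 - c / b) * W t := by
    intro t
    have hscaled : c / b * W t ≤ c * X t := by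
      calc c / b * W t ≤ c / b * (b * X t) := by gcongr; exact hupper t
        _ = c * X t := by field_simp
    linarith [hdecrease t]
  rw [mul_assoc, div_mul_eq_mul_div, le_div_iff₀' ha]
  calc a * X t ≤ W t := hlower t
    _ ≤ (1 - c / b) ^ t * W 0 := le_geom hratio t fun k _ => hcontract k
    _ ≤ (1 - c / b) ^ t * (b * X 0) := by gcongr; exact hupper 0
    _ = b * ((1 - c / b) ^ t * X 0) := by ring

/-- The sum of `w` over the window of length `l` starting at `t`; for `w` the squared distances to
the setpoint this is the squared distance of the extended state. -/
def windowSum (l : ℕ) (w : ℕ → ℝ) (t : ℕ) : ℝ := ∑ i ∈ Finset.range l, w (t + i)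

/-- The window sum with weights `1, …, l`, the newest entry being the heaviest. Moving the window
by one step costs each entry one unit of weight; this makes `rampSum` a storage function that
decreases by the whole window sum up to the contribution of the entering sample. -/
def rampSum (l : ℕ) (w : ℕ → ℝ) (t : ℕ) : ℝ := ∑ i ∈ Finset.range l, ((i : ℝ) + 1) * w (t + i)

variable {l : ℕ} {w V : ℕ → ℝ}

lemma windowSum_le_rampSum (hw : ∀ k, 0 ≤ w k) (t : ℕ) : windowSum l w t ≤ rampSum l w t :=
  Finset.sum_le_sum fun _ _ => le_mul_of_one_le_left (hw _) (by simp)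

lemma rampSum_le_mul_windowSum (hw : ∀ k, 0 ≤ w k) (t : ℕ) :
    rampSum l w t ≤ l * windowSum l w t := by
  rw [rampSum, windowSum, Finset.mul_sum]
  refine Finset.sum_le_sum fun i hi => mul_le_mul_of_nonneg_right ?_ (hw _)
  exact_mod_cast Finset.mem_range.1 hi

lemma rampSum_succ (l : ℕ) (w : ℕ → ℝ) (t : ℕ) :
    rampSum l w (t + 1) = rampSum l w t - windowSum l w t + l * w (l + t) := by
  induction l with
  | zero => simp [rampSum, windowSum]
  | succ l ih =>
    simp only [rampSum, windowSum, Finset.sum_range_succ] at ih ⊢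
    rw [ih, add_comm t l, show t + 1 + l = l + 1 + t by omega]
    push_cast
    ring

lemma windowSum_le_geometric {ε κ : ℝ} (hε : 0 < ε) (hκ : 0 < κ) (hw : ∀ k, 0 ≤ w k)
    (hV : ∀ t, 0 ≤ V t) (hVle : ∀ t, V t ≤ κ * windowSum l w t)
    (hVdec : ∀ t, V (t + 1) ≤ V t - ε * (l + 1) * w (l + t)) (t : ℕ) :
    windowSum l w t ≤
      (κ + ε * (l + 1)) / ε * (1 - ε / (κ + ε * (l + 1))) ^ t * windowSum l w 0 := by
  have hεl : 0 ≤ ε * l := by positivity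
  have hsum : ∀ t, 0 ≤ windowSum l w t := fun t => Finset.sum_nonneg fun _ _ => hw _
  refine le_geometric_of_sandwich (W := fun t => V t + ε * rampSum l w t) hε (by positivity) hε.le
    (by linarith) (fun t => ?_) (fun t => ?_) (fun t => ?_) t
  · have := mul_le_mul_of_nonneg_left (windowSum_le_rampSum (l := l) hw t) hε.le
    linarith [hV t]
  · have := mul_le_mul_of_nonneg_left (rampSum_le_mul_windowSum (l := l) hw t) hε.le
    linarith [hVle t, mul_nonneg hε.le (hsum t)]
  · rw [rampSum_succ]
    linarith [hVdec t, mul_nonneg hε.le (hw (l + t))]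

lemma le_sqrt_mul_sqrt_pow_mul {a b C q : ℝ} (hb : 0 ≤ b) (hC : 0 ≤ C) (hq : 0 ≤ q) {t : ℕ}
    (h : a ^ 2 ≤ C * q ^ t * b ^ 2) : a ≤ √C * √q ^ t * b := by
  refine le_of_abs_le (abs_le_of_sq_le_sq ?_ (by positivity))
  rwa [mul_pow, mul_pow, ← pow_mul, mul_comm t, pow_mul, Real.sq_sqrt hC, Real.sq_sqrt hq]

end ExponentialDecay

namespace MPC

variable {n m p l L N T : ℕ} {S : LTI n m p} {E : ARX m p} {M : MPC m p l L N}
  {K : Matrix (Fin m) (ExtIdx l m p) ℝ} {ξ : ExtIdx l m p → ℝ} {d : Decision m p l L N}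
  {x : ℕ → Fin n → ℝ} {u u' : ℕ → Fin m → ℝ} {y y' : ℕ → Fin p → ℝ}

/-- The cost of the input `v` and the output `z` at one time step. -/
def stageCost (M : MPC m p l L N) (v : Fin m → ℝ) (z : Fin p → ℝ) : ℝ :=
  wsq M.R (v - M.us) + wsq M.Q (z - M.ys)

/-- The cost of the signals `u`, `y` over the horizon `T`; `M.cost` is the case `T = L`. As in a
`Decision`, step `k` has the index `l + k`. -/
def costOver (M : MPC m p l L N) (T : ℕ) (u : ℕ → Fin m → ℝ) (y : ℕ → Fin p → ℝ) : ℝ :=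
  ∑ k ∈ Finset.range T, M.stageCost (u (l + k)) (y (l + k)) + wsq M.P (window l u y T - M.xis)

/-- `u`, `y` satisfy the constraints of the optimal control problem with horizon `T`, the
prediction model being the system itself in place of the data. -/
structure IsAdmissible (M : MPC m p l L N) (S : LTI n m p) (T : ℕ) (u : ℕ → Fin m → ℝ)
    (y : ℕ → Fin p → ℝ) : Prop where
  trajectory : S.IsTrajectory (T + l) u y
  terminal : window l u y T ∈ M.Xf
  input : ∀ k < T, u (l + k) ∈ M.U
  output : ∀ k < T, y (l + k) ∈ M.Y

/-- `u'`, `y'` continue `u`, `y` beyond the horizon `T` by one step of the system under the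
terminal control law. -/
structure IsTerminalStep (M : MPC m p l L N) (S : LTI n m p)
    (K : Matrix (Fin m) (ExtIdx l m p) ℝ) (T : ℕ) (u : ℕ → Fin m → ℝ) (y : ℕ → Fin p → ℝ)
    (u' : ℕ → Fin m → ℝ) (y' : ℕ → Fin p → ℝ) : Prop where
  trajectory : S.IsTrajectory (T + (l + 1)) u' y'
  input_eq : ∀ k < T + l, u' k = u k
  output_eq : ∀ k < T + l, y' k = y k
  feedback : u' (l + T) = M.us + K *ᵥ (window l u y T - M.xis)

lemma exists_isTerminalStep (h : S.IsTrajectory (T + l) u y) :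
    ∃ u' y', M.IsTerminalStep S K T u y u' y' := by
  obtain ⟨z, hz⟩ := h.exists_update (M.us + K *ᵥ (window l u y T - M.xis))
  refine ⟨_, _, hz, fun k hk => Function.update_of_ne hk.ne _ _,
    fun k hk => Function.update_of_ne hk.ne _ _, ?_⟩
  rw [add_comm l, Function.update_self]

namespace IsTerminalStep

lemma window_eq (h : M.IsTerminalStep S K T u y u' y') {t : ℕ} (ht : t ≤ T) :
    window l u' y' t = window l u y t :=
  window_congr (fun i _ => h.input_eq _ (by omega)) fun i _ => h.output_eq _ (by omega)

lemma step (h : M.IsTerminalStep S K T u y u' y') (hE : E.Describes l S) :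
    window l u' y' (T + 1) =
        E.At l *ᵥ window l u y T + E.Bt l *ᵥ (M.us + K *ᵥ (window l u y T - M.xis)) ∧
      y' (l + T) =
        E.Ct l *ᵥ window l u y T + E.Dt *ᵥ (M.us + K *ᵥ (window l u y T - M.xis)) := by
  rw [← h.feedback, ← h.window_eq le_rfl]
  exact hE.step h.trajectory

lemma window_succ_sub_xis (h : M.IsTerminalStep S K T u y u' y') (hE : E.Describes l S)
    (heq : S.IsEquilibrium l M.us M.ys) :
    window l u' y' (T + 1) - M.xis =
      (E.At l + E.Bt l * K) *ᵥ (window l u y T - M.xis) := by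
  have hfixed : M.xis = E.At l *ᵥ M.xis + E.Bt l *ᵥ M.us := hE.constExt_eq heq
  rw [(h.step hE).1, sub_eq_iff_eq_add]
  nth_rw 3 [hfixed]
  rw [add_mulVec, ← mulVec_mulVec, mulVec_add (E.Bt l), mulVec_sub (E.At l)]
  abel

lemma isAdmissible (h : M.IsTerminalStep S K T u y u' y') (hE : E.Describes l S)
    (hterm : M.TerminalIngredients E K) (hadm : M.IsAdmissible S T u y) :
    M.IsAdmissible S (T + 1) u' y' := by
  obtain ⟨hwindow, houtput⟩ := h.step hE
  refine ⟨?_, hwindow ▸ hterm.invariant _ hadm.terminal, fun k hk => ?_, fun k hk => ?_⟩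
  · rw [add_right_comm]
    exact h.trajectory
  all_goals rcases Nat.lt_succ_iff_lt_or_eq.1 hk with hk | rfl
  · exact h.input_eq (l + k) (by omega) ▸ hadm.input k hk
  · exact h.feedback ▸ hterm.input _ hadm.terminal
  · exact h.output_eq (l + k) (by omega) ▸ hadm.output k hk
  · exact houtput ▸ hterm.output _ hadm.terminal

lemma costOver_succ_le (h : M.IsTerminalStep S K T u y u' y') (hE : E.Describes l S)
    (heq : S.IsEquilibrium l M.us M.ys) (hterm : M.TerminalIngredients E K)
    (hmem : window l u y T ∈ M.Xf) : M.costOver (T + 1) u' y' ≤ M.costOver T u y := by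
  have hsum : ∑ k ∈ Finset.range T, M.stageCost (u' (l + k)) (y' (l + k)) =
      ∑ k ∈ Finset.range T, M.stageCost (u (l + k)) (y (l + k)) := by
    refine Finset.sum_congr rfl fun k hk => ?_
    have hk' : l + k < T + l := by have := Finset.mem_range.1 hk; omega
    rw [h.input_eq _ hk', h.output_eq _ hk']
  have hdecrease := hterm.decrease _ hmem
  rw [← h.window_succ_sub_xis hE heq, ← (h.step hE).2, wsq_transpose_mul_mul] at hdecrease
  rw [costOver, costOver, Finset.sum_range_succ, hsum, stageCost, h.feedback,
    add_sub_cancel_left]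
  linarith

end IsTerminalStep

lemma IsAdmissible.shift (h : M.IsAdmissible S (T + 1) u y) :
    M.IsAdmissible S T (fun k => u (1 + k)) (fun k => y (1 + k)) where
  trajectory := LTI.IsTrajectory.shift (h.trajectory.mono (by omega))
  terminal := by
    rw [window_shift, add_comm]
    exact h.terminal
  input k hk := by
    rw [add_left_comm, add_comm 1]
    exact h.input (k + 1) (by omega)
  output k hk := by
    rw [add_left_comm, add_comm 1]
    exact h.output (k + 1) (by omega)

lemma costOver_succ (T : ℕ) (u : ℕ → Fin m → ℝ) (y : ℕ → Fin p → ℝ) :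
    M.costOver (T + 1) u y = M.stageCost (u l) (y l) +
      M.costOver T (fun k => u (1 + k)) (fun k => y (1 + k)) := by
  rw [costOver, costOver, Finset.sum_range_succ', window_shift, add_comm 1 T, add_zero,
    add_right_comm, add_comm (M.stageCost _ _)]
  simp only [add_left_comm 1 l, add_comm 1]

lemma IsAdmissible.of_window_mem (hterm : M.TerminalIngredients E K) (hE : E.Describes l S)
    (h : S.IsTrajectory l u y) (hmem : window l u y 0 ∈ M.Xf) (T : ℕ) :
    ∃ u' y', M.IsAdmissible S T u' y' ∧ window l u' y' 0 = window l u y 0 := by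
  induction T with
  | zero => exact ⟨u, y, ⟨by rwa [zero_add], hmem, by simp, by simp⟩, rfl⟩
  | succ T ih =>
    obtain ⟨u₁, y₁, hadm, hw⟩ := ih
    obtain ⟨u', y', hstep⟩ := M.exists_isTerminalStep (K := K) hadm.trajectory
    exact ⟨u', y', hstep.isAdmissible hE hterm hadm, (hstep.window_eq T.zero_le).trans hw⟩

lemma IsFeasible.isAdmissible (h : M.IsFeasible ξ d)
    (hrep : S.IsRepresentedBy (L + l) N M.ud M.yd) : M.IsAdmissible S L d.u d.y :=
  ⟨(hrep _ _).2 ⟨d.α, h.hankel_u, h.hankel_y⟩, h.terminal, h.input, h.output⟩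

lemma IsAdmissible.exists_isFeasible (h : M.IsAdmissible S L u y)
    (hrep : S.IsRepresentedBy (L + l) N M.ud M.yd) :
    ∃ d, M.IsFeasible (window l u y 0) d ∧ M.cost d = M.costOver L u y :=
  let ⟨α, hu, hy⟩ := (hrep _ _).1 h.trajectory
  ⟨⟨α, u, y⟩, ⟨hu, hy, rfl, h.terminal, h.input, h.output⟩, rfl⟩

lemma TerminalIngredients.feasible (hterm : M.TerminalIngredients E K) (hE : E.Describes l S)
    (hrep : S.IsRepresentedBy (L + l) N M.ud M.yd) (h : S.IsTrajectory l u y)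
    (hmem : window l u y 0 ∈ M.Xf) : M.Feasible (window l u y 0) := by
  obtain ⟨u', y', hadm, hw⟩ := IsAdmissible.of_window_mem hterm hE h hmem L
  obtain ⟨d, hd, -⟩ := hadm.exists_isFeasible hrep
  exact ⟨d, hw ▸ hd⟩

lemma IsFeasible.exists_successor (h : M.IsFeasible ξ d) (hL : 1 ≤ L) (hE : E.Describes l S)
    (hrep : S.IsRepresentedBy (L + l) N M.ud M.yd) (heq : S.IsEquilibrium l M.us M.ys)
    (hterm : M.TerminalIngredients E K) :
    ∃ d', M.IsFeasible (window l d.u d.y 1) d' ∧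
      M.cost d' ≤ M.cost d - M.stageCost (d.u l) (d.y l) := by
  have hadm := h.isAdmissible hrep
  obtain ⟨u', y', hstep⟩ := M.exists_isTerminalStep (K := K) hadm.trajectory
  obtain ⟨d', hd', hcost⟩ := (hstep.isAdmissible hE hterm hadm).shift.exists_isFeasible hrep
  rw [window_shift, hstep.window_eq hL] at hd'
  have hle : M.costOver (L + 1) u' y' ≤ M.cost d :=
    hstep.costOver_succ_le hE heq hterm h.terminal
  rw [costOver_succ, ← hcost, hstep.input_eq l (by omega), hstep.output_eq l (by omega)] at hle
  exact ⟨d', hd', by linarith⟩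

lemma cost_nonneg (hQ : M.Q.PosSemidef) (hR : M.R.PosSemidef) (hP : M.P.PosSemidef)
    (d : Decision m p l L N) : 0 ≤ M.cost d :=
  add_nonneg (Finset.sum_nonneg fun _ _ => add_nonneg (wsq_nonneg hR _) (wsq_nonneg hQ _))
    (wsq_nonneg hP _)

lemma value_nonneg (hQ : M.Q.PosSemidef) (hR : M.R.PosSemidef) (hP : M.P.PosSemidef)
    (ξ : ExtIdx l m p → ℝ) : 0 ≤ M.value ξ :=
  Real.sInf_nonneg (Set.forall_mem_image.2 fun d _ => cost_nonneg hQ hR hP d)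

lemma IsOptimal.isLeast (h : M.IsOptimal ξ d) :
    IsLeast (M.cost '' {d | M.IsFeasible ξ d}) (M.cost d) :=
  ⟨⟨d, h.1, rfl⟩, Set.forall_mem_image.2 fun _ hd' => h.2 _ hd'⟩

lemma exists_pos_mul_le_stageCost (hQ : M.Q.PosDef) (hR : M.R.PosDef) :
    ∃ c : ℝ, 0 < c ∧ ∀ v z,
      c * (norm2 (v - M.us) ^ 2 + norm2 (z - M.ys) ^ 2) ≤ M.stageCost v z := by
  obtain ⟨cR, hcR, hRle⟩ := exists_pos_mul_norm2_sq_le_wsq hR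
  obtain ⟨cQ, hcQ, hQle⟩ := exists_pos_mul_norm2_sq_le_wsq hQ
  refine ⟨min cR cQ, lt_min hcR hcQ, fun v z => ?_⟩
  rw [mul_add]
  exact add_le_add
    ((mul_le_mul_of_nonneg_right (min_le_left cR cQ) (sq_nonneg _)).trans (hRle _))
    ((mul_le_mul_of_nonneg_right (min_le_right cR cQ) (sq_nonneg _)).trans (hQle _))

namespace ClosedLoop

lemma exists_isOptimal (hcl : M.ClosedLoop S x u y) (hL : 1 ≤ L) (hE : E.Describes l S)
    (hrep : S.IsRepresentedBy (L + l) N M.ud M.yd) {t : ℕ} (hfeas : M.Feasible (window l u y t)) :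
    ∃ d, M.IsOptimal (window l u y t) d ∧ d.u l = u (l + t) ∧ d.y l = y (l + t) ∧
      window l d.u d.y 1 = window l u y (t + 1) := by
  obtain ⟨d, hd, hu⟩ := hcl.control t hfeas
  have hdtraj : S.IsTrajectory (0 + (l + 1)) d.u d.y :=
    (hd.1.isAdmissible hrep).trajectory.mono (by omega)
  obtain ⟨hwindow, houtput⟩ :=
    hE.eq_of_window_eq hdtraj ⟨x, fun k _ => hcl.plant k⟩ hd.1.init hu.symm
  exact ⟨d, hd, hu.symm, houtput, hwindow⟩

lemma mem_constraints (hcl : M.ClosedLoop S x u y) (hL : 1 ≤ L) (hE : E.Describes l S)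
    (hrep : S.IsRepresentedBy (L + l) N M.ud M.yd) {t : ℕ} (hfeas : M.Feasible (window l u y t)) :
    u (l + t) ∈ M.U ∧ y (l + t) ∈ M.Y := by
  obtain ⟨d, hd, hu, hy, -⟩ := hcl.exists_isOptimal hL hE hrep hfeas
  exact ⟨hu ▸ hd.1.input 0 hL, hy ▸ hd.1.output 0 hL⟩

lemma feasible_succ (hcl : M.ClosedLoop S x u y) (hL : 1 ≤ L) (hE : E.Describes l S)
    (hrep : S.IsRepresentedBy (L + l) N M.ud M.yd) (heq : S.IsEquilibrium l M.us M.ys)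
    (hterm : M.TerminalIngredients E K) {t : ℕ} (hfeas : M.Feasible (window l u y t)) :
    M.Feasible (window l u y (t + 1)) := by
  obtain ⟨d, hd, -, -, hw⟩ := hcl.exists_isOptimal hL hE hrep hfeas
  obtain ⟨d', hd', -⟩ := hd.1.exists_successor hL hE hrep heq hterm
  exact ⟨d', hw ▸ hd'⟩

lemma feasible (hcl : M.ClosedLoop S x u y) (hL : 1 ≤ L) (hE : E.Describes l S)
    (hrep : S.IsRepresentedBy (L + l) N M.ud M.yd) (heq : S.IsEquilibrium l M.us M.ys)
    (hterm : M.TerminalIngredients E K) (h₀ : M.Feasible (window l u y 0)) (t : ℕ) :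
    M.Feasible (window l u y t) := by
  induction t with
  | zero => exact h₀
  | succ t ih => exact hcl.feasible_succ hL hE hrep heq hterm ih

lemma value_succ_le (hcl : M.ClosedLoop S x u y) (hL : 1 ≤ L) (hE : E.Describes l S)
    (hrep : S.IsRepresentedBy (L + l) N M.ud M.yd) (heq : S.IsEquilibrium l M.us M.ys)
    (hterm : M.TerminalIngredients E K) {t : ℕ} (hfeas : M.Feasible (window l u y t)) :
    M.value (window l u y (t + 1)) ≤
      M.value (window l u y t) - M.stageCost (u (l + t)) (y (l + t)) := by
  obtain ⟨d, hd, hu, hy, hw⟩ := hcl.exists_isOptimal hL hE hrep hfeas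
  obtain ⟨d', hd', hcost⟩ := hd.1.exists_successor hL hE hrep heq hterm
  rw [hw] at hd'
  obtain ⟨e, he, -⟩ := hcl.control (t + 1) ⟨d', hd'⟩
  rw [value, value, he.isLeast.csInf_eq, hd.isLeast.csInf_eq, ← hu, ← hy]
  exact (he.2 d' hd').trans hcost

lemma norm2_window_sub_xis_sq_le (hcl : M.ClosedLoop S x u y) (hL : 1 ≤ L)
    (hE : E.Describes l S) (hrep : S.IsRepresentedBy (L + l) N M.ud M.yd)
    (hQ : M.Q.PosSemidef) (hR : M.R.PosSemidef) (heq : S.IsEquilibrium l M.us M.ys)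
    (hterm : M.TerminalIngredients E K) {ε κ : ℝ} (hε : 0 < ε) (hκ : 0 < κ)
    (hstage : ∀ v z, ε * (l + 1) * (norm2 (v - M.us) ^ 2 + norm2 (z - M.ys) ^ 2) ≤
      M.stageCost v z)
    (hvalue : ∀ ξ, M.Feasible ξ → M.value ξ ≤ κ * norm2 (ξ - M.xis) ^ 2)
    (h₀ : M.Feasible (window l u y 0)) (t : ℕ) :
    norm2 (window l u y t - M.xis) ^ 2 ≤
      (κ + ε * (l + 1)) / ε * (1 - ε / (κ + ε * (l + 1))) ^ t *
        norm2 (window l u y 0 - M.xis) ^ 2 := by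
  have hfeas := hcl.feasible hL hE hrep heq hterm h₀
  let w : ℕ → ℝ := fun k => norm2 (u k - M.us) ^ 2 + norm2 (y k - M.ys) ^ 2
  have hwindow : ∀ t, norm2 (window l u y t - M.xis) ^ 2 = windowSum l w t :=
    norm2_window_sub_constExt_sq M.us M.ys
  rw [hwindow, hwindow]
  refine windowSum_le_geometric (V := fun t => M.value (window l u y t)) hε hκ
    (fun k => by positivity) (fun t => value_nonneg hQ hR hterm.posDef.posSemidef _)
    (fun t => hwindow t ▸ hvalue _ (hfeas t)) (fun t => ?_) t
  exact (hcl.value_succ_le hL hE hrep heq hterm (hfeas t)).trans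
    (sub_le_sub_left (hstage _ _) _)

end ClosedLoop

lemma exists_exponential_bound (hL : 1 ≤ L) (hE : E.Describes l S)
    (hrep : S.IsRepresentedBy (L + l) N M.ud M.yd) (hQ : M.Q.PosDef) (hR : M.R.PosDef)
    (heq : S.IsEquilibrium l M.us M.ys) (hterm : M.TerminalIngredients E K)
    (hbound : M.QuadUpperBound) :
    ∃ c ρ : ℝ, 0 < c ∧ 0 < ρ ∧ ρ < 1 ∧ ∀ x u y, M.ClosedLoop S x u y →
      M.Feasible (window l u y 0) → ∀ t : ℕ,
        norm2 (window l u y t - M.xis) ≤ c * ρ ^ t * norm2 (window l u y 0 - M.xis) := by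
  obtain ⟨c, hc, hstage⟩ := exists_pos_mul_le_stageCost hQ hR
  obtain ⟨κ, hκ, hvalue⟩ := hbound
  obtain ⟨ε, hε, rfl⟩ : ∃ ε : ℝ, 0 < ε ∧ ε * (l + 1) = c :=
    ⟨c / (l + 1), by positivity, div_mul_cancel₀ c (by positivity)⟩
  have hC : 0 < (κ + ε * (l + 1)) / ε := by positivity
  have hq : 0 < 1 - ε / (κ + ε * (l + 1)) := by
    rw [sub_pos, div_lt_one (by positivity)]
    nlinarith [mul_nonneg hε.le (Nat.cast_nonneg (α := ℝ) l)]
  have hq' : 1 - ε / (κ + ε * (l + 1)) < 1 := sub_lt_self _ (by positivity)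
  refine ⟨√_, √_, Real.sqrt_pos.2 hC, Real.sqrt_pos.2 hq, (Real.sqrt_lt' one_pos).2 (by
    rwa [one_pow]), fun x u y hcl h₀ t => ?_⟩
  exact le_sqrt_mul_sqrt_pow_mul (norm_nonneg _) hC.le hq.le
    (hcl.norm2_window_sub_xis_sq_le hL hE hrep hQ.posSemidef hR.posSemidef heq hterm hε hκ
      hstage hvalue h₀ t)

end MPC

end DDMPC

theorem theorem2_general {n m p l L N : ℕ} (S : DDMPC.LTI n m p) (E : DDMPC.ARX m p)
    (M : DDMPC.MPC m p l L N) (K : Matrix (Fin m) (DDMPC.ExtIdx l m p) ℝ) (hL : 1 ≤ L)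
    (hE : E.Describes l S) (hrep : S.IsRepresentedBy (L + l) N M.ud M.yd)
    (hQ : M.Q.PosDef) (hR : M.R.PosDef) (heq : S.IsEquilibrium l M.us M.ys)
    (hterm : M.TerminalIngredients E K) (hbound : M.QuadUpperBound) :
    (∀ x u y, M.ClosedLoop S x u y → M.Feasible (DDMPC.window l u y 0) →
      (∀ t : ℕ, M.Feasible (DDMPC.window l u y t)) ∧
      (∀ t : ℕ, u (l + t) ∈ M.U ∧ y (l + t) ∈ M.Y)) ∧
    M.ExponentiallyStable S := by
  refine ⟨fun x u y hcl h₀ => ?_, ?_,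
    DDMPC.MPC.exists_exponential_bound hL hE hrep hQ hR heq hterm hbound⟩
  · have hfeas := hcl.feasible hL hE hrep heq hterm h₀
    exact ⟨hfeas, fun t => hcl.mem_constraints hL hE hrep (hfeas t)⟩
  · obtain ⟨δ, hδ, hmem⟩ := DDMPC.exists_pos_norm2_sub_lt_imp_mem hterm.setpoint
    exact ⟨δ, hδ, fun u y htraj hlt => hterm.feasible hE hrep htraj (hmem _ hlt)⟩

theorem theorem2 {n m p l L N l₀ : ℕ} (S : DDMPC.LTI n m p) (E : DDMPC.ARX m p)
    (M : DDMPC.MPC m p l L N) (K : Matrix (Fin m) (DDMPC.ExtIdx l m p) ℝ)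
    (hctrb : S.Controllable) (hobsv : S.Observable)
    (hlag : S.IsLag l₀) (hl : l₀ ≤ l) (hL : 1 ≤ L)
    (hE : E.Describes l S)
    (hdata : S.IsTrajectory N M.ud M.yd)
    (hQ : M.Q.PosDef) (hR : M.R.PosDef)
    (heq : S.IsEquilibrium l₀ M.us M.ys)
    (hint : (M.us, M.ys) ∈ interior (M.U ×ˢ M.Y))
    (hterm : M.TerminalIngredients E K)
    (hbound : M.QuadUpperBound)
    (hpe : DDMPC.PersistentlyExciting (L + l + n) N M.ud) :
    (∀ x u y, M.ClosedLoop S x u y → M.Feasible (DDMPC.window l u y 0) →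
      (∀ t : ℕ, M.Feasible (DDMPC.window l u y t)) ∧
      (∀ t : ℕ, u (l + t) ∈ M.U ∧ y (l + t) ∈ M.Y)) ∧
    M.ExponentiallyStable S :=
  theorem2_general S E M K hL hE (hctrb.isRepresentedBy hdata hpe) hQ hR
    (heq.of_rank_obsvMatrix hlag.1.2.2 l) hterm hbound
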